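/- Let $\chi$ be a real, primitive and non-principal Dirichlet character of conductor $q$ (so $q>1$), and let $\chi^*$ be a completely multiplicative extension of $\chi$, i.e. $\chi^*$ is completely multiplicative on the positive integers, $\chi^*(n)=\chi(n)$ whenever $\gcd(n,q)=1$, and $\chi^*(p)\in\{-1,1\}$ for each prime $p\mid q$. Let $f_1=\mu^2\chi^*$, where $\mu$ is the Möbius function, and $f_2=\mu_2^2\chi^*$, where $\mu_2^2$ is the indicator function of the cubefree integers (those not divisible by the cube of a prime). Then for $f\in\{f_1,f_2\}$ and every integer $H\ge 1$ the limit $$\Lambda_f(H)=\lim_{x\to\infty}\frac1x\sum_{n\le x}\Bigl|\sum_{k=n+1}^{n+H}f(k)\Bigr|^2$$ exists, and there is a constant $C>0$, depending only on $\chi$ and $\chi^*$, such that for all integers $H\ge1$ $$\Lambda_{f_1}(H)\le C\,H^{1/2}\qquad\text{and}\qquad \Lambda_{f_2}(H)\le C\,H^{1/3}.$$ -/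

import Mathlib

open Filter Topology

/-- `χs` is a completely multiplicative extension of the real Dirichlet character `χ` modulo `q`:
it is completely multiplicative on the positive integers, it agrees with `χ` on the integers
coprime to `q`, and it takes one of the values `1`, `-1` at each prime dividing `q`.
The value `χs 0` plays no role. -/
structure IsCompletelyMultiplicativeExtension {q : ℕ} (χ : DirichletCharacter ℝ q)
    (χs : ℕ → ℝ) : Prop where
  map_one : χs 1 = 1
  map_mul : ∀ m n : ℕ, 0 < m → 0 < n → χs (m * n) = χs m * χs n
  eq_of_coprime : ∀ n : ℕ, 0 < n → Nat.Coprime n q → χs n = χ (n : ZMod q)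
  prime_dvd : ∀ p : ℕ, p.Prime → p ∣ q → χs p = 1 ∨ χs p = -1

/-- `n` is cubefree: it is not divisible by the cube of a prime. -/
def IsCubefree (n : ℕ) : Prop := ∀ p : ℕ, p.Prime → ¬ p ^ 3 ∣ n

open Classical in
/-- The indicator function of the cubefree integers. -/
noncomputable def cubefreeIndicator (n : ℕ) : ℝ := if IsCubefree n then 1 else 0

/-- The restriction of `g` to the squarefree integers, `n ↦ μ(n)² g(n)`. -/
noncomputable def squarefreePart (g : ℕ → ℝ) (n : ℕ) : ℝ :=
  ((ArithmeticFunction.moebius n : ℤ) : ℝ) ^ 2 * g n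

/-- The restriction of `g` to the cubefree integers. -/
noncomputable def cubefreePart (g : ℕ → ℝ) (n : ℕ) : ℝ := cubefreeIndicator n * g n

/-- The mean square `(1 / x) ∑_{1 ≤ n ≤ x} |f (n + 1) + ⋯ + f (n + H)|²` of the sums of `f`
over intervals of length `H`. -/
noncomputable def shortSumMeanSquare (f : ℕ → ℝ) (H : ℕ) (x : ℝ) : ℝ :=
  1 / x * ∑ n ∈ Finset.Icc 1 ⌊x⌋₊, |∑ k ∈ Finset.Icc (n + 1) (n + H), f k| ^ 2

/-- The mean square of the sums of `f` over intervals of length `H` has the limit `L`. -/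
def HasLimitingMeanSquare (f : ℕ → ℝ) (H : ℕ) (L : ℝ) : Prop :=
  Tendsto (fun x : ℝ => shortSumMeanSquare f H x) atTop (𝓝 L)

/-! Both claims are instances of a bound `O(H^(1/k))` for the `k`-free part of `χs`, `k ≥ 2`. A
`k`-free `n` is `e * m` with `e = gcd(n, q^k)` and `m` coprime to `q`, so this function is a finite
combination of dilates by `e` of the `k`-free part of `χ` (`powerFreePart_eq_dilationSum`). If only
the primes `p ≤ Y` not dividing `q` are sieved out, inclusion-exclusion gives a periodic function: a
finite combination of dilates of `χ` by `e * d^k`, with `d` squarefree and coprime to `q`.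

The window sums of one dilate are bounded, because partial sums of `χ` are, and the dilate by `g`
lives on multiples of `g`; hence its mean square is `≪ min(1, H/g)`. For `d₁ = D a`, `d₂ = D b` with
`D` the gcd, the Chinese remainder theorem shows that the window sums of the two dilates have
correlation `χ(a^k) χ(b^k) / (ab)^k` times the mean square for `e * D^k`
(`sum_windowSum_dilatedChar_correlation`). The sums over `a` and `b` converge, and `∑ min(1, H/D^k)
≪ H^(1/k)`. This gives the bound uniformly in `Y` (`sum_sq_combination_windowSum_le`).

Finally, sieving up to `Y` errs only on integers divisible by some `d^2` with `d > Y`, of density at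
most `1/Y`. The mean squares therefore converge uniformly in `x` as `Y → ∞`, and both the limit and
its bound pass to the full `k`-free part (`exists_tendsto_of_approx`). -/

/-- The dilation of a Dirichlet character by `a`: it is `χ (n / a)` at the multiples of `a`. -/
noncomputable def dilatedChar {q : ℕ} (χ : DirichletCharacter ℝ q) (a n : ℕ) : ℝ :=
  if a ∣ n then χ ((n / a : ℕ) : ZMod q) else 0

/-! ### Window sums and periodic sequences. -/

/-- The sum of `f` over the window `n + 1, …, n + H`. -/
def windowSum (f : ℕ → ℝ) (H n : ℕ) : ℝ := ∑ k ∈ Finset.Icc (n + 1) (n + H), f k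

theorem windowSum_eq_sum_range (f : ℕ → ℝ) (H n : ℕ) :
    windowSum f H n = ∑ k ∈ Finset.range H, f (n + 1 + k) := by
  unfold windowSum
  rw [show Finset.Icc (n + 1) (n + H) = Finset.Ico (n + 1) (n + H + 1) from rfl,
    Finset.sum_Ico_eq_sum_range]
  congr 2
  omega

theorem windowSum_periodic {f : ℕ → ℝ} {N : ℕ} (hf : Function.Periodic f N) (H : ℕ) :
    Function.Periodic (windowSum f H) N := by
  intro n
  simp only [windowSum_eq_sum_range]
  refine Finset.sum_congr rfl fun k _ => ?_
  rw [show n + N + 1 + k = n + 1 + k + N by ring, hf]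

theorem periodic_of_dvd {f : ℕ → ℝ} {M N : ℕ} (hf : Function.Periodic f M) (h : M ∣ N) :
    Function.Periodic f N := by
  obtain ⟨c, rfl⟩ := h
  rw [mul_comm]
  exact hf.nat_mul c

theorem sum_range_add_of_periodic {f : ℕ → ℝ} {N : ℕ} (hf : Function.Periodic f N) (c : ℕ) :
    ∑ n ∈ Finset.range N, f (n + c) = ∑ n ∈ Finset.range N, f n := by
  induction c with
  | zero => simp
  | succ c ih =>
    have h1 := Finset.sum_range_succ (fun n => f (n + c)) N
    have h2 := Finset.sum_range_succ' (fun n => f (n + c)) N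
    have h3 : f (N + c) = f (0 + c) := by rw [add_comm N c, hf, zero_add]
    simp only [show ∀ n, n + (c + 1) = n + 1 + c by intro n; ring]
    linarith

/-! ### Window sums of dilated characters: correlations and mean squares. -/

section Character

variable {q : ℕ} (χ : DirichletCharacter ℝ q)

theorem abs_char_le_one (x : ZMod q) : |χ x| ≤ 1 := by
  simpa using χ.norm_le_one x

theorem char_sq_eq_one {n : ℕ} (h : n.Coprime q) : χ (n : ZMod q) ^ 2 = 1 := by
  have := χ.unit_norm_eq_one (ZMod.unitOfCoprime n h)
  rw [ZMod.coe_unitOfCoprime, Real.norm_eq_abs] at this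
  rw [← sq_abs, this, one_pow]

theorem char_eq_zero_of_not_coprime {n : ℕ} (h : ¬ n.Coprime q) : χ (n : ZMod q) = 0 :=
  χ.map_nonunit (by rwa [ZMod.isUnit_iff_coprime])

theorem char_periodic : Function.Periodic (fun n : ℕ => χ (n : ZMod q)) q := by
  intro n
  simp

theorem sum_range_char_add (hq : 0 < q) (hne : χ ≠ 1) (n : ℕ) :
    ∑ m ∈ Finset.range q, χ ((m + n : ℕ) : ZMod q) = 0 := by
  rw [sum_range_add_of_periodic (char_periodic χ) n]
  have : NeZero q := ⟨hq.ne'⟩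
  rw [← MulChar.sum_eq_zero_of_ne_one hne]
  refine Finset.sum_nbij' (fun m => (m : ZMod q)) ZMod.val ?_ ?_ ?_ ?_ ?_
  · simp
  · intro a _; simpa using ZMod.val_lt a
  · intro a ha; exact ZMod.val_cast_of_lt (by simpa using ha)
  · intro a _; simp
  · simp

/-- Full periods cancel, which leaves fewer than `q` terms of size at most 1. -/
theorem abs_sum_range_char_le (hq : 0 < q) (hne : χ ≠ 1) (M : ℕ) :
    |∑ m ∈ Finset.range M, χ (m : ZMod q)| ≤ q := by
  induction M using Nat.strong_induction_on with
  | _ M ih =>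
    by_cases h : M < q
    · calc |∑ m ∈ Finset.range M, χ (m : ZMod q)|
          ≤ ∑ m ∈ Finset.range M, |χ (m : ZMod q)| := Finset.abs_sum_le_sum_abs _ _
        _ ≤ ∑ m ∈ Finset.range M, (1 : ℝ) := Finset.sum_le_sum fun m _ => abs_char_le_one χ _
        _ ≤ q := by simpa using h.le
    · push Not at h
      obtain ⟨c, rfl⟩ := Nat.exists_eq_add_of_le' h
      rw [Finset.sum_range_add]
      have := sum_range_char_add χ hq hne c
      simp only [add_comm c]
      rw [this, add_zero]
      exact ih c (by omega)

theorem dilatedChar_mul_left {g : ℕ} (hg : 0 < g) (a n : ℕ) :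
    dilatedChar χ (g * a) (g * n) = dilatedChar χ a n := by
  unfold dilatedChar
  simp only [Nat.mul_dvd_mul_iff_left hg, Nat.mul_div_mul_left _ _ hg]

theorem abs_dilatedChar_le (a n : ℕ) : |dilatedChar χ a n| ≤ if a ∣ n then 1 else 0 := by
  unfold dilatedChar
  split_ifs
  · exact abs_char_le_one χ _
  · simp

theorem dilatedChar_periodic {a : ℕ} (ha : 0 < a) :
    Function.Periodic (dilatedChar χ a) (a * q) := by
  intro n
  unfold dilatedChar
  simp [Nat.dvd_add_left (dvd_mul_right a q), Nat.add_mul_div_left _ _ ha]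

/-- Since `r` is invertible modulo `a`, the condition fixes the residue class of `j`. -/
theorem card_filter_dvd_add_mul {a r : ℕ} (ha : 0 < a) (h : a.Coprime r) (n : ℕ) :
    ((Finset.range a).filter fun j => a ∣ n + r * j).card = 1 := by
  have : NeZero a := ⟨ha.ne'⟩
  let u := ZMod.unitOfCoprime r h.symm
  have key : ∀ j : ℕ, a ∣ n + r * j ↔ (j : ZMod a) = -(↑u⁻¹ * n) := by
    intro j
    rw [← ZMod.natCast_eq_zero_iff]
    have hu : ((r : ℕ) : ZMod a) = u := (ZMod.coe_unitOfCoprime r h.symm).symm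
    push_cast
    rw [hu]
    constructor
    · intro h0
      have : (j : ZMod a) = ↑u⁻¹ * (n + u * j) - ↑u⁻¹ * n := by
        rw [mul_add, ← mul_assoc, Units.inv_mul]; ring
      rw [this, h0]; ring
    · intro h0
      rw [h0, mul_neg, ← mul_assoc, Units.mul_inv]; ring
  rw [Finset.card_eq_one]
  refine ⟨(-(↑u⁻¹ * (n : ZMod a))).val, ?_⟩
  ext j
  simp only [Finset.mem_filter, Finset.mem_range, Finset.mem_singleton, key]
  constructor
  · rintro ⟨h1, h2⟩
    rw [← h2, ZMod.val_cast_of_lt h1]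
  · rintro rfl
    exact ⟨ZMod.val_lt _, by simp⟩

/-- Write `n = g * m`. The shifts preserve `m` modulo `q`, and exactly one of them makes `m` a
multiple `a * t`. There `χ(t) = χ(a) χ(m)`, because `χ(a)² = 1` for a real character. -/
theorem sum_dilatedChar_shift {g a c : ℕ} (hg : 0 < g) (ha : 0 < a) (h : a.Coprime (q * c))
    (n : ℕ) :
    ∑ j ∈ Finset.range a, dilatedChar χ (g * a) (n + g * q * c * j) =
      χ (a : ZMod q) * dilatedChar χ g n := by
  by_cases hn : g ∣ n
  · obtain ⟨m, rfl⟩ := hn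
    have haq : a.Coprime q := h.coprime_mul_right_right
    have h1 : ∀ j, dilatedChar χ (g * a) (g * m + g * q * c * j) =
        if a ∣ m + q * c * j then χ (a : ZMod q) * χ (m : ZMod q) else 0 := by
      intro j
      rw [show g * m + g * q * c * j = g * (m + q * c * j) by ring, dilatedChar_mul_left χ hg]
      unfold dilatedChar
      split_ifs with hd
      · obtain ⟨t, ht⟩ := hd
        have h2 : χ (m : ZMod q) = χ (a : ZMod q) * χ (t : ZMod q) := by
          rw [← map_mul, ← Nat.cast_mul, ← ht]
          simp
        rw [ht, Nat.mul_div_cancel_left _ ha, h2, ← mul_assoc, ← sq, char_sq_eq_one χ haq,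
          one_mul]
      · rfl
    have h3 : dilatedChar χ g (g * m) = χ (m : ZMod q) := by
      simp [dilatedChar, Nat.mul_div_cancel_left _ hg]
    simp only [h1, h3]
    rw [← Finset.sum_filter, Finset.sum_const, card_filter_dvd_add_mul ha h, one_smul]
  · have h1 : ∀ j, dilatedChar χ (g * a) (n + g * q * c * j) = 0 := by
      intro j
      unfold dilatedChar
      rw [if_neg]
      intro hd
      have := (dvd_mul_right g a).trans hd
      rw [show g * q * c * j = g * (q * c * j) by ring, Nat.dvd_add_left (dvd_mul_right _ _)] at this
      exact hn this
    rw [Finset.sum_congr rfl fun j _ => h1 j]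
    simp [dilatedChar, hn]

/-- Shifting by `g * q * c * j` leaves `G` unchanged, so the first factor may be averaged over `j <
a`; this replaces the dilate by `g * a` with the dilate by `g`. -/
theorem sum_windowSum_dilatedChar_mul {g a c N : ℕ} (hg : 0 < g) (ha : 0 < a)
    (h : a.Coprime (q * c)) (hN : g * a * q ∣ N) (H : ℕ) {G : ℕ → ℝ}
    (hG : Function.Periodic G (g * q * c)) (hGN : Function.Periodic G N) :
    a * ∑ n ∈ Finset.range N, windowSum (dilatedChar χ (g * a)) H n * G n =
      χ (a : ZMod q) * ∑ n ∈ Finset.range N, windowSum (dilatedChar χ g) H n * G n := by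
  have hper : Function.Periodic (windowSum (dilatedChar χ (g * a)) H) N :=
    windowSum_periodic (periodic_of_dvd (dilatedChar_periodic χ (by positivity)) hN) H
  have h1 : ∀ j : ℕ, ∑ n ∈ Finset.range N, windowSum (dilatedChar χ (g * a)) H n * G n =
      ∑ n ∈ Finset.range N, windowSum (dilatedChar χ (g * a)) H (n + g * q * c * j) * G n := by
    intro j
    refine (sum_range_add_of_periodic (hper.mul hGN) (g * q * c * j)).symm.trans
      (Finset.sum_congr rfl fun n _ => ?_)
    simp only [Pi.mul_apply]
    rw [(periodic_of_dvd hG (dvd_mul_right _ j)) n]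
  have h2 : ∀ n, ∑ j ∈ Finset.range a, windowSum (dilatedChar χ (g * a)) H (n + g * q * c * j) =
      χ (a : ZMod q) * windowSum (dilatedChar χ g) H n := by
    intro n
    simp only [windowSum_eq_sum_range]
    rw [Finset.sum_comm, Finset.mul_sum]
    refine Finset.sum_congr rfl fun k _ => ?_
    rw [← sum_dilatedChar_shift χ hg ha h]
    refine Finset.sum_congr rfl fun j _ => ?_
    congr 1
    ring
  calc _ = ∑ j ∈ Finset.range a, ∑ n ∈ Finset.range N,
          windowSum (dilatedChar χ (g * a)) H (n + g * q * c * j) * G n := by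
        simp [← h1]
    _ = _ := by
        rw [Finset.sum_comm, Finset.mul_sum]
        refine Finset.sum_congr rfl fun n _ => ?_
        rw [← Finset.sum_mul, h2, mul_assoc]

/-- The correlation of the window sums of two dilates of `χ`. -/
theorem sum_windowSum_dilatedChar_correlation {g a b N : ℕ} (hg : 0 < g) (ha : 0 < a)
    (hb : 0 < b) (hab : a.Coprime b) (haq : a.Coprime q) (hbq : b.Coprime q)
    (haN : g * a * q ∣ N) (hbN : g * b * q ∣ N) (H : ℕ) :
    (a * b : ℝ) * ∑ n ∈ Finset.range N,
        windowSum (dilatedChar χ (g * a)) H n * windowSum (dilatedChar χ (g * b)) H n =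
      χ (a : ZMod q) * χ (b : ZMod q) *
        ∑ n ∈ Finset.range N, windowSum (dilatedChar χ g) H n ^ 2 := by
  have hper : ∀ x, 0 < x → Function.Periodic (windowSum (dilatedChar χ x) H) (x * q) :=
    fun x hx => windowSum_periodic (dilatedChar_periodic χ hx) H
  -- The factor `a` is removed against the dilate by `g * b`, whose period is `g * q * b`; then `b`
  -- is removed against the dilate by `g`.
  have h1 := sum_windowSum_dilatedChar_mul χ (c := b) hg ha (haq.mul_right hab) haN H
    (G := windowSum (dilatedChar χ (g * b)) H)
    (by rw [mul_right_comm]; exact hper _ (by positivity))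
    (periodic_of_dvd (hper _ (by positivity)) hbN)
  have h2 := sum_windowSum_dilatedChar_mul χ (c := 1) hg hb (by simpa using hbq) hbN H
    (G := windowSum (dilatedChar χ g) H)
    (by rw [mul_one]; exact hper _ hg)
    (periodic_of_dvd (hper _ hg) (dvd_trans (by rw [mul_right_comm]; exact dvd_mul_right _ _) haN))
  simp only [sq]
  simp only [mul_comm (windowSum (dilatedChar χ (g * b)) H _)] at h2
  linear_combination (b : ℝ) * h1 + χ (a : ZMod q) * h2

theorem sum_range_dilatedChar (g M : ℕ) :
    ∑ k ∈ Finset.range M, dilatedChar χ g (k + 1) =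
      ∑ m ∈ Finset.range (M / g), χ ((m + 1 : ℕ) : ZMod q) := by
  induction M with
  | zero => simp
  | succ M ih =>
    rw [Finset.sum_range_succ, ih, Nat.succ_div]
    unfold dilatedChar
    split_ifs with h
    · rw [Finset.sum_range_succ, Nat.succ_div_of_dvd h]
    · simp

theorem abs_windowSum_dilatedChar_le (hq : 0 < q) (hne : χ ≠ 1) (g H n : ℕ) :
    |windowSum (dilatedChar χ g) H n| ≤ 4 * q := by
  -- Starting the sum at 1 instead of 0 costs `|χ 0| ≤ 1 ≤ q`. A window is a difference of two such
  -- sums, whence `4 * q`.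
  have hX : ∀ M, |∑ m ∈ Finset.range M, χ ((m + 1 : ℕ) : ZMod q)| ≤ 2 * q := by
    intro M
    have h1 := Finset.sum_range_succ' (fun m : ℕ => χ (m : ZMod q)) M
    have h2 := abs_sum_range_char_le χ hq hne (M + 1)
    have h3 := abs_char_le_one χ ((0 : ℕ) : ZMod q)
    have h4 : (1 : ℝ) ≤ q := by exact_mod_cast hq
    rw [h1] at h2
    rw [abs_le] at *
    constructor <;> linarith
  have h1 : windowSum (dilatedChar χ g) H n =
      ∑ k ∈ Finset.range (n + H), dilatedChar χ g (k + 1) -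
        ∑ k ∈ Finset.range n, dilatedChar χ g (k + 1) := by
    rw [Finset.sum_range_add, windowSum_eq_sum_range, add_sub_cancel_left]
    refine Finset.sum_congr rfl fun k _ => ?_
    congr 1
    ring
  rw [h1, sum_range_dilatedChar, sum_range_dilatedChar]
  refine (abs_sub _ _).trans ?_
  linarith [hX ((n + H) / g), hX (n / g)]

theorem card_filter_dvd_range {g N : ℕ} (hg : 0 < g) (h : g ∣ N) :
    (g : ℝ) * ∑ n ∈ Finset.range N, (if g ∣ n then (1 : ℝ) else 0) = N := by
  obtain ⟨c, rfl⟩ := h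
  have : ∀ c : ℕ, ∑ n ∈ Finset.range (g * c), (if g ∣ n then (1 : ℝ) else 0) = c := by
    intro c
    induction c with
    | zero => simp
    | succ c ih =>
      rw [mul_add, mul_one, Finset.sum_range_add, ih]
      have : ∀ x ∈ Finset.range g, (if g ∣ g * c + x then (1 : ℝ) else 0) =
          if x = 0 then 1 else 0 := by
        intro x hx
        have hx0 : g ∣ g * c + x ↔ x = 0 := by
          rw [Nat.dvd_add_right (dvd_mul_right _ _)]
          exact ⟨fun h => Nat.eq_zero_of_dvd_of_lt h (by simpa using hx), by rintro rfl; simp⟩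
        simp only [hx0]
      rw [Finset.sum_congr rfl this]
      simp [hg]
  rw [this]
  push_cast
  ring

theorem sum_windowSum_dilatedChar_sq_le (hq : 0 < q) (hne : χ ≠ 1) {g N : ℕ} (hg : 0 < g)
    (hN : g * q ∣ N) (H : ℕ) :
    ∑ n ∈ Finset.range N, windowSum (dilatedChar χ g) H n ^ 2 ≤
      16 * q ^ 2 * N * min 1 ((H : ℝ) / g) := by
  have hq1 : (1 : ℝ) ≤ q := by exact_mod_cast hq
  have hg0 : (0 : ℝ) < g := by exact_mod_cast hg
  have hT := abs_windowSum_dilatedChar_le χ hq hne g H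
  rw [mul_min_of_nonneg _ _ (by positivity), le_min_iff]
  constructor
  · calc _ ≤ ∑ n ∈ Finset.range N, (4 * q : ℝ) ^ 2 :=
          Finset.sum_le_sum fun n _ => sq_le_sq' (abs_le.1 (hT n)).1 (abs_le.1 (hT n)).2
      _ = _ := by simp; ring
  -- The first moment counts multiples of `g` in windows; one factor of the square is then bounded
  -- by `4 * q`.
  · have h1 : ∑ n ∈ Finset.range N, |windowSum (dilatedChar χ g) H n| ≤ H * (N / g) := by
      calc _ ≤ ∑ n ∈ Finset.range N, ∑ k ∈ Finset.range H,
              (if g ∣ n + (1 + k) then (1 : ℝ) else 0) := by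
            refine Finset.sum_le_sum fun n _ => ?_
            rw [windowSum_eq_sum_range]
            refine (Finset.abs_sum_le_sum_abs _ _).trans (Finset.sum_le_sum fun k _ => ?_)
            rw [add_assoc]
            exact abs_dilatedChar_le χ _ _
        _ = ∑ k ∈ Finset.range H, (N / g : ℝ) := by
            rw [Finset.sum_comm]
            refine Finset.sum_congr rfl fun k _ => ?_
            rw [sum_range_add_of_periodic (f := fun n => if g ∣ n then (1 : ℝ) else 0)]
            · rw [eq_div_iff hg0.ne', mul_comm]
              exact card_filter_dvd_range hg ((dvd_mul_right g q).trans hN)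
            · intro n
              simp only [Nat.dvd_add_left ((dvd_mul_right g q).trans hN)]
        _ = _ := by simp
    calc _ ≤ ∑ n ∈ Finset.range N, (4 * q : ℝ) * |windowSum (dilatedChar χ g) H n| := by
          refine Finset.sum_le_sum fun n _ => ?_
          rw [← sq_abs, sq]
          exact mul_le_mul_of_nonneg_right (hT n) (abs_nonneg _)
      _ ≤ 4 * q * (H * (N / g)) := by
          rw [← Finset.mul_sum]
          exact mul_le_mul_of_nonneg_left h1 (by positivity)
      _ ≤ 16 * q ^ 2 * (H * (N / g)) := by
          refine mul_le_mul_of_nonneg_right ?_ (by positivity)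
          nlinarith
      _ = _ := by ring

end Character

/-! ### Sums over gcds and cofactors, and the quadratic form in the dilates. -/

theorem sum_Icc_one_div_pow_le {k : ℕ} (hk : 2 ≤ k) (N : ℕ) :
    ∑ x ∈ Finset.Icc 1 N, 1 / (x : ℝ) ^ k ≤ 2 := by
  calc _ ≤ ∑ x ∈ Finset.Icc 1 N, ((x : ℝ) ^ 2)⁻¹ := by
        refine Finset.sum_le_sum fun x hx => ?_
        have : (1 : ℝ) ≤ x := by exact_mod_cast (Finset.mem_Icc.1 hx).1
        rw [one_div]
        exact inv_anti₀ (by positivity) (pow_le_pow_right₀ this hk)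
    _ ≤ 2 := by
        have := sum_Ioo_inv_sq_le (α := ℝ) 0 (N + 1)
        rw [show Finset.Icc 1 N = Finset.Ioo 0 (N + 1) by ext; simp; omega]
        simpa using this

/-- The sum is split at `R = ⌈H^(1/k)⌉`. The head is at most `R ≤ 2h`. In the tail `(h/D)^k ≤
(h/D)^2`, so it is at most `h²/R ≤ h`. -/
theorem sum_Icc_min_le {k : ℕ} (hk : 2 ≤ k) {H : ℕ} (hH : 1 ≤ H) (N : ℕ) :
    ∑ D ∈ Finset.Icc 1 N, min 1 ((H : ℝ) / (D : ℝ) ^ k) ≤ 3 * (H : ℝ) ^ ((1 : ℝ) / k) := by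
  set h : ℝ := (H : ℝ) ^ ((1 : ℝ) / k) with hdef
  have hH1 : (1 : ℝ) ≤ H := by exact_mod_cast hH
  have h1 : 1 ≤ h := Real.one_le_rpow hH1 (by positivity)
  have hpow : h ^ k = H := by
    rw [hdef, one_div]
    exact Real.rpow_inv_natCast_pow (by positivity) (by omega)
  set R := ⌈h⌉₊ with hR
  have hR1 : h ≤ R := Nat.le_ceil h
  have hR2 : (R : ℝ) ≤ 2 * h := by linarith [Nat.ceil_lt_add_one (show 0 ≤ h by linarith)]
  have hR0 : R ≠ 0 := by
    rintro h0
    rw [h0] at hR1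
    norm_num at hR1
    linarith
  -- Enlarging the range to `R + N` ensures that the splitting point `R` lies in it.
  calc _ ≤ ∑ D ∈ Finset.Icc 1 (R + N), min 1 ((H : ℝ) / (D : ℝ) ^ k) := by
        refine Finset.sum_le_sum_of_subset_of_nonneg
          (Finset.Icc_subset_Icc_right (by omega)) fun D _ _ => by positivity
    _ = ∑ D ∈ Finset.Ioc 0 R, min 1 ((H : ℝ) / (D : ℝ) ^ k) +
        ∑ D ∈ Finset.Ioc R (R + N), min 1 ((H : ℝ) / (D : ℝ) ^ k) := by
        rw [Finset.sum_Ioc_consecutive _ (by omega) (by omega)]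
        rfl
    _ ≤ ∑ D ∈ Finset.Ioc 0 R, (1 : ℝ) +
        ∑ D ∈ Finset.Ioc R (R + N), h ^ 2 * ((D : ℝ) ^ 2)⁻¹ := by
        refine add_le_add (Finset.sum_le_sum fun D _ => min_le_left _ _)
          (Finset.sum_le_sum fun D hD => (min_le_right _ _).trans ?_)
        have hD1 : (R : ℝ) < D := by exact_mod_cast (Finset.mem_Ioc.1 hD).1
        have hD0 : (0 : ℝ) < D := by linarith
        rw [← hpow, ← div_pow, ← div_eq_mul_inv, ← div_pow]
        exact pow_le_pow_of_le_one (by positivity) ((div_le_one hD0).2 (by linarith)) hk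
    _ ≤ R + h ^ 2 * (R : ℝ)⁻¹ := by
        rw [← Finset.mul_sum]
        refine add_le_add (by simp) (mul_le_mul_of_nonneg_left ?_ (by positivity))
        refine (sum_Ioc_inv_sq_le_sub hR0 (by omega)).trans ?_
        have : (0 : ℝ) ≤ ((R + N : ℕ) : ℝ)⁻¹ := by positivity
        linarith
    _ ≤ 3 * h := by
        have : h ^ 2 * (R : ℝ)⁻¹ ≤ h := by
          rw [← div_eq_mul_inv, div_le_iff₀ (by linarith), sq]
          exact mul_le_mul_of_nonneg_left hR1 (by linarith)
        linarith

/-- A sum over pairs that depends on the gcd and the two cofactors is at most the sum over all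
triples of a gcd and two cofactors. -/
theorem sum_pairs_gcd_le {ι : Type*} (I : Finset ι) (d : ι → ℕ) (hd : ∀ i ∈ I, 0 < d i)
    (hinj : Set.InjOn d I) {k : ℕ} (hk : 2 ≤ k) (W : ℕ → ℝ) (hW : ∀ D, 0 ≤ W D) {M : ℕ}
    (hM : ∀ i ∈ I, d i ≤ M) :
    ∑ i ∈ I, ∑ j ∈ I, W ((d i).gcd (d j)) *
      (1 / ((d i / (d i).gcd (d j) : ℕ) : ℝ) ^ k * (1 / ((d j / (d i).gcd (d j) : ℕ) : ℝ) ^ k)) ≤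
    4 * ∑ D ∈ Finset.Icc 1 M, W D := by
  classical
  let F : ℕ × ℕ × ℕ → ℝ := fun x => W x.1 * (1 / (x.2.1 : ℝ) ^ k * (1 / (x.2.2 : ℝ) ^ k))
  let φ : ι × ι → ℕ × ℕ × ℕ := fun x =>
    ((d x.1).gcd (d x.2), d x.1 / (d x.1).gcd (d x.2), d x.2 / (d x.1).gcd (d x.2))
  -- The gcd times a cofactor recovers `d i`, and `d` is injective.
  have hφ : Set.InjOn φ (I ×ˢ I : Finset (ι × ι)) := by
    rintro ⟨i, j⟩ hij ⟨i', j'⟩ hij' h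
    simp only [Finset.coe_product, Set.mem_prod, Finset.mem_coe] at hij hij'
    simp only [φ, Prod.mk.injEq] at h
    obtain ⟨h0, h1, h2⟩ := h
    rw [← h0] at h1 h2
    have e1 : d i = d i' := by
      rw [← Nat.div_mul_cancel (Nat.gcd_dvd_left (d i) (d j)), h1,
        Nat.div_mul_cancel (h0 ▸ Nat.gcd_dvd_left _ _)]
    have e2 : d j = d j' := by
      rw [← Nat.div_mul_cancel (Nat.gcd_dvd_right (d i) (d j)), h2,
        Nat.div_mul_cancel (h0 ▸ Nat.gcd_dvd_right _ _)]
    rw [hinj hij.1 hij'.1 e1, hinj hij.2 hij'.2 e2]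
  have hF : ∀ x, 0 ≤ F x := fun x => mul_nonneg (hW _) (by positivity)
  set J := Finset.Icc 1 M
  calc _ = ∑ x ∈ I ×ˢ I, F (φ x) := by rw [Finset.sum_product]
    _ = ∑ y ∈ (I ×ˢ I).image φ, F y := (Finset.sum_image hφ).symm
    _ ≤ ∑ y ∈ J ×ˢ J ×ˢ J, F y := by
        refine Finset.sum_le_sum_of_subset_of_nonneg ?_ fun y _ _ => hF y
        intro y hy
        obtain ⟨⟨i, j⟩, hij, rfl⟩ := Finset.mem_image.1 hy
        obtain ⟨hi, hj⟩ := Finset.mem_product.1 hij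
        have hi0 := hd _ hi
        have hj0 := hd _ hj
        have hg : 0 < (d i).gcd (d j) := Nat.gcd_pos_of_pos_left _ hi0
        simp only [Finset.mem_product, J, φ, Finset.mem_Icc]
        exact ⟨⟨hg, (Nat.gcd_le_left _ hi0).trans (hM _ hi)⟩,
          ⟨Nat.div_pos (Nat.gcd_le_left _ hi0) hg, (Nat.div_le_self _ _).trans (hM _ hi)⟩,
          ⟨Nat.div_pos (Nat.gcd_le_right _ hj0) hg, (Nat.div_le_self _ _).trans (hM _ hj)⟩⟩
    _ = (∑ D ∈ J, W D) *
        ((∑ x ∈ J, 1 / (x : ℝ) ^ k) * ∑ x ∈ J, 1 / (x : ℝ) ^ k) := by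
        rw [Finset.sum_product, Finset.sum_mul]
        refine Finset.sum_congr rfl fun D _ => ?_
        rw [Finset.sum_product, Finset.sum_mul_sum, Finset.mul_sum]
        refine Finset.sum_congr rfl fun x _ => ?_
        rw [Finset.mul_sum]
    _ ≤ (∑ D ∈ J, W D) * (2 * 2) := by
        have := sum_Icc_one_div_pow_le hk M
        have h0 : 0 ≤ ∑ x ∈ J, 1 / (x : ℝ) ^ k := Finset.sum_nonneg fun _ _ => by positivity
        refine mul_le_mul_of_nonneg_left ?_ (Finset.sum_nonneg fun _ _ => hW _)
        exact mul_le_mul this this h0 (by norm_num)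
    _ = _ := by ring

/-- The square is expanded and each pair is evaluated by its correlation. The constant is `192 = 4 *
16 * 3`: the cofactor sums, the mean square of one dilate, and the sum over gcds. -/
theorem sum_sq_combination_windowSum_le {q : ℕ} (χ : DirichletCharacter ℝ q) (hq : 0 < q)
    (hne : χ ≠ 1) {ι : Type*} (I : Finset ι) (d : ι → ℕ) (hd : ∀ i ∈ I, 0 < d i)
    (hdq : ∀ i ∈ I, (d i).Coprime q) (hinj : Set.InjOn d I) (c : ι → ℝ)
    (hc : ∀ i ∈ I, |c i| ≤ 1) {k : ℕ} (hk : 2 ≤ k) {e : ℕ} (he : 0 < e) {N : ℕ}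
    (hN : ∀ i ∈ I, e * d i ^ k * q ∣ N) {H : ℕ} (hH : 1 ≤ H) :
    ∑ n ∈ Finset.range N, (∑ i ∈ I, c i * windowSum (dilatedChar χ (e * d i ^ k)) H n) ^ 2 ≤
      192 * q ^ 2 * N * (H : ℝ) ^ ((1 : ℝ) / k) := by
  set T : ι → ℕ → ℝ := fun i n => windowSum (dilatedChar χ (e * d i ^ k)) H n with hT
  have hpair : ∀ i ∈ I, ∀ j ∈ I, |∑ n ∈ Finset.range N, T i n * T j n| ≤
      (16 * q ^ 2 * N * min 1 ((H : ℝ) / (((d i).gcd (d j) : ℕ) : ℝ) ^ k)) *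
      (1 / ((d i / (d i).gcd (d j) : ℕ) : ℝ) ^ k *
        (1 / ((d j / (d i).gcd (d j) : ℕ) : ℝ) ^ k)) := by
    intro i hi j hj
    have hD : 0 < (d i).gcd (d j) := Nat.gcd_pos_of_pos_left _ (hd i hi)
    have hcop := Nat.coprime_div_gcd_div_gcd hD
    obtain ⟨a, ha⟩ := Nat.gcd_dvd_left (d i) (d j)
    obtain ⟨b, hb⟩ := Nat.gcd_dvd_right (d i) (d j)
    have ha' : d i / (d i).gcd (d j) = a := Nat.div_eq_of_eq_mul_right hD ha
    have hb' : d j / (d i).gcd (d j) = b := Nat.div_eq_of_eq_mul_right hD hb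
    rw [ha', hb'] at hcop ⊢
    set D := (d i).gcd (d j) with hDdef
    have ha0 : 0 < a := Nat.pos_of_ne_zero (by rintro rfl; have := hd i hi; omega)
    have hb0 : 0 < b := Nat.pos_of_ne_zero (by rintro rfl; have := hd j hj; omega)
    have haq : a.Coprime q := (hdq i hi).coprime_dvd_left (Dvd.intro_left D ha.symm)
    have hbq : b.Coprime q := (hdq j hj).coprime_dvd_left (Dvd.intro_left D hb.symm)
    have ei : e * d i ^ k = e * D ^ k * a ^ k := by
      conv_lhs => rw [ha]
      rw [mul_pow, mul_assoc]
    have ej : e * d j ^ k = e * D ^ k * b ^ k := by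
      conv_lhs => rw [hb]
      rw [mul_pow, mul_assoc]
    have hiN := hN i hi
    have hjN := hN j hj
    have hTi : T i = windowSum (dilatedChar χ (e * D ^ k * a ^ k)) H := by rw [← ei]
    have hTj : T j = windowSum (dilatedChar χ (e * D ^ k * b ^ k)) H := by rw [← ej]
    rw [ei] at hiN
    rw [ej] at hjN
    have hg : 0 < e * D ^ k := by positivity
    have hcor := sum_windowSum_dilatedChar_correlation χ (a := a ^ k) (b := b ^ k) hg
      (by positivity) (by positivity) (hcop.pow k k) (haq.pow_left k) (hbq.pow_left k) hiN hjN H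
    have hV := sum_windowSum_dilatedChar_sq_le χ hq hne hg
      ((Dvd.intro (a ^ k) (by ring)).trans hiN) H
    rw [← hTi, ← hTj] at hcor
    have hmin : min 1 ((H : ℝ) / ((e * D ^ k : ℕ) : ℝ)) ≤ min 1 ((H : ℝ) / (D : ℝ) ^ k) := by
      refine min_le_min_left _ (div_le_div_of_nonneg_left (by positivity) (by positivity) ?_)
      push_cast
      have : (1 : ℝ) ≤ e := by exact_mod_cast he
      nlinarith [show (0 : ℝ) < (D : ℝ) ^ k by positivity]
    have hchi : |χ ((a ^ k : ℕ) : ZMod q) * χ ((b ^ k : ℕ) : ZMod q)| ≤ 1 := by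
      rw [abs_mul]
      exact mul_le_one₀ (abs_char_le_one χ _) (abs_nonneg _) (abs_char_le_one χ _)
    have hab : (0 : ℝ) < (a : ℝ) ^ k * (b : ℝ) ^ k := by positivity
    have h1 := congrArg abs hcor
    rw [abs_mul, abs_mul (χ _ * χ _),
      abs_of_nonneg (Finset.sum_nonneg fun n _ => sq_nonneg
        (windowSum (dilatedChar χ (e * D ^ k)) H n))] at h1
    push_cast at h1 hchi
    rw [abs_of_pos hab] at h1
    rw [one_div_mul_one_div, mul_one_div, le_div_iff₀ hab, mul_comm, h1]
    calc _ ≤ 1 * ∑ n ∈ Finset.range N, windowSum (dilatedChar χ (e * D ^ k)) H n ^ 2 :=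
          mul_le_mul_of_nonneg_right hchi (Finset.sum_nonneg fun _ _ => sq_nonneg _)
      _ ≤ _ := by
          rw [one_mul]
          exact hV.trans (mul_le_mul_of_nonneg_left hmin (by positivity))
  calc ∑ n ∈ Finset.range N, (∑ i ∈ I, c i * T i n) ^ 2
      = ∑ i ∈ I, ∑ j ∈ I, c i * c j * ∑ n ∈ Finset.range N, T i n * T j n := by
        simp only [sq, Finset.sum_mul_sum]
        rw [Finset.sum_comm]
        refine Finset.sum_congr rfl fun i _ => ?_
        rw [Finset.sum_comm]
        refine Finset.sum_congr rfl fun j _ => ?_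
        rw [Finset.mul_sum]
        exact Finset.sum_congr rfl fun n _ => by ring
    _ ≤ ∑ i ∈ I, ∑ j ∈ I, (16 * q ^ 2 * N * min 1 ((H : ℝ) / (((d i).gcd (d j) : ℕ) : ℝ) ^ k)) *
        (1 / ((d i / (d i).gcd (d j) : ℕ) : ℝ) ^ k *
          (1 / ((d j / (d i).gcd (d j) : ℕ) : ℝ) ^ k)) := by
        refine Finset.sum_le_sum fun i hi => Finset.sum_le_sum fun j hj => ?_
        refine (le_abs_self _).trans ?_
        rw [abs_mul, abs_mul]
        refine le_trans ?_ (hpair i hi j hj)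
        exact mul_le_of_le_one_left (abs_nonneg _)
          (mul_le_one₀ (hc i hi) (abs_nonneg _) (hc j hj))
    _ ≤ 4 * ∑ D ∈ Finset.Icc 1 (I.sup d), 16 * q ^ 2 * N * min 1 ((H : ℝ) / (D : ℝ) ^ k) :=
        sum_pairs_gcd_le I d hd hinj hk
          (fun D => 16 * q ^ 2 * N * min 1 ((H : ℝ) / (D : ℝ) ^ k)) (fun D => by positivity)
          (fun i hi => Finset.le_sup hi)
    _ ≤ 4 * (16 * q ^ 2 * N * (3 * (H : ℝ) ^ ((1 : ℝ) / k))) := by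
        rw [← Finset.mul_sum]
        gcongr
        exact sum_Icc_min_le hk hH _
    _ = _ := by ring

/-! ### Power-free integers: reduction to `χ` and the sieve error. -/

/-- `n` is not divisible by the `k`-th power of a prime. -/
def IsPowerFree (k n : ℕ) : Prop := ∀ p : ℕ, p.Prime → ¬ p ^ k ∣ n

open Classical in
/-- The restriction of `g` to the `k`-free integers. -/
noncomputable def powerFreePart (k : ℕ) (g : ℕ → ℝ) (n : ℕ) : ℝ :=
  if IsPowerFree k n then g n else 0

/-- The product of `g` with the indicator of the integers not divisible by `p ^ k` for `p ∈ P`. -/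
noncomputable def sievedPart (k : ℕ) (P : Finset ℕ) (g : ℕ → ℝ) (n : ℕ) : ℝ :=
  g n * ∏ p ∈ P, (1 - if p ^ k ∣ n then 1 else 0)

open Classical in
/-- The divisors of `q ^ k` that are `k`-free. -/
noncomputable def powerFreeDivisors (q k : ℕ) : Finset ℕ :=
  (q ^ k).divisors.filter (IsPowerFree k)

/-- The sum over `e ∈ E` of `w e` times the dilation of `g` by `e`. -/
noncomputable def dilationSum (E : Finset ℕ) (w g : ℕ → ℝ) (n : ℕ) : ℝ :=
  ∑ e ∈ E, w e * if e ∣ n then g (n / e) else 0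

theorem IsPowerFree.of_dvd {k m n : ℕ} (hn : IsPowerFree k n) (h : m ∣ n) : IsPowerFree k m :=
  fun p hp hpm => hn p hp (hpm.trans h)

theorem IsPowerFree.mul {k m n : ℕ} (hm : IsPowerFree k m) (hn : IsPowerFree k n)
    (h : m.Coprime n) : IsPowerFree k (m * n) := by
  intro p hp hd
  have hk : k ≠ 0 := by
    rintro rfl
    exact hm p hp (by simp)
  rcases (Nat.Coprime.isPrimePow_dvd_mul h (hp.isPrimePow.pow hk)).1 hd with h1 | h1
  · exact hm p hp h1
  · exact hn p hp h1

/-- If a prime `p ∣ q` divided the cofactor, then `p ^ j ∣ n` would put `p ^ j` into the gcd and so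
give `p ^ (j + 1) ∣ n`, up to `p ^ k ∣ n`. -/
theorem coprime_div_gcd_pow {k q n : ℕ} (hn0 : 0 < n) (hn : IsPowerFree k n) :
    (n / n.gcd (q ^ k)).Coprime q := by
  refine Nat.coprime_of_dvd fun p hp hpn hpq => ?_
  have hg : 0 < n.gcd (q ^ k) := Nat.gcd_pos_of_pos_left _ hn0
  have key : ∀ j ≤ k, p ^ j ∣ n := by
    intro j
    induction j with
    | zero => simp
    | succ j ih =>
      intro hj
      have h1 : p ^ j ∣ n.gcd (q ^ k) :=
        Nat.dvd_gcd (ih (by omega)) ((pow_dvd_pow p (by omega)).trans (pow_dvd_pow_of_dvd hpq k))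
      rw [pow_succ, ← Nat.mul_div_cancel' (Nat.gcd_dvd_left n (q ^ k))]
      exact mul_dvd_mul h1 hpn
  exact hn p hp (key k le_rfl)

/-- As `χ` vanishes off the integers coprime to `q`, only `e = gcd(n, q^k)` can contribute. -/
theorem powerFreePart_eq_dilationSum {q : ℕ} {χ : DirichletCharacter ℝ q} {χs : ℕ → ℝ}
    (hχs : IsCompletelyMultiplicativeExtension χ χs) (hq : 0 < q) (k : ℕ) {n : ℕ} (hn : 0 < n) :
    powerFreePart k χs n = dilationSum (powerFreeDivisors q k) χs
      (powerFreePart k fun m => χ (m : ZMod q)) n := by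
  have hterm : ∀ e ∈ powerFreeDivisors q k, e ∣ n → IsPowerFree k (n / e) →
      (n / e).Coprime q → IsPowerFree k n ∧ e = n.gcd (q ^ k) := by
    intro e he hen hfree hcop
    simp only [powerFreeDivisors, Finset.mem_filter, Nat.mem_divisors] at he
    obtain ⟨m, rfl⟩ := hen
    have he0 : 0 < e := Nat.pos_of_mul_pos_right hn
    rw [Nat.mul_div_cancel_left _ he0] at hfree hcop
    have hmq : m.Coprime (q ^ k) := hcop.pow_right k
    refine ⟨he.2.mul hfree (hmq.coprime_dvd_right he.1.1).symm, ?_⟩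
    rw [hmq.gcd_mul_right_cancel, Nat.gcd_eq_left he.1.1]
  unfold dilationSum
  by_cases hfree : IsPowerFree k n
  · have hE : n.gcd (q ^ k) ∈ powerFreeDivisors q k := by
      simp only [powerFreeDivisors, Finset.mem_filter, Nat.mem_divisors]
      exact ⟨⟨Nat.gcd_dvd_right _ _, by positivity⟩, hfree.of_dvd (Nat.gcd_dvd_left _ _)⟩
    have hg : 0 < n.gcd (q ^ k) := Nat.gcd_pos_of_pos_left _ hn
    have hdiv : 0 < n / n.gcd (q ^ k) := Nat.div_pos (Nat.gcd_le_left _ hn) hg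
    rw [Finset.sum_eq_single_of_mem _ hE]
    · rw [if_pos (Nat.gcd_dvd_left _ _), powerFreePart, powerFreePart, if_pos hfree,
        if_pos (hfree.of_dvd (Nat.div_dvd_of_dvd (Nat.gcd_dvd_left _ _))),
        ← hχs.eq_of_coprime _ hdiv (coprime_div_gcd_pow hn hfree), ← hχs.map_mul _ _ hg hdiv,
        Nat.mul_div_cancel' (Nat.gcd_dvd_left _ _)]
    · intro e he hne
      by_cases hen : e ∣ n
      · rw [if_pos hen, powerFreePart, if_pos (hfree.of_dvd (Nat.div_dvd_of_dvd hen)),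
          char_eq_zero_of_not_coprime, mul_zero]
        exact fun hc => hne (hterm e he hen (hfree.of_dvd (Nat.div_dvd_of_dvd hen)) hc).2
      · rw [if_neg hen, mul_zero]
  · rw [powerFreePart, if_neg hfree, Finset.sum_eq_zero]
    intro e he
    by_cases hen : e ∣ n
    · rw [if_pos hen, powerFreePart]
      split_ifs with h1
      · rw [char_eq_zero_of_not_coprime, mul_zero]
        exact fun hc => hfree (hterm e he hen h1 hc).1
      · simp
    · rw [if_neg hen, mul_zero]

theorem prod_one_sub_indicator {k : ℕ} (P : Finset ℕ) (n : ℕ) :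
    ∏ p ∈ P, (1 - if p ^ k ∣ n then (1 : ℝ) else 0) = if ∃ p ∈ P, p ^ k ∣ n then 0 else 1 := by
  split_ifs with h
  · obtain ⟨p, hp, hpn⟩ := h
    exact Finset.prod_eq_zero hp (by simp [hpn])
  · push Not at h
    exact Finset.prod_eq_one fun p hp => by simp [h p hp]

/-- The primes up to `Y` that do not divide `q`. -/
def primesUpTo (q Y : ℕ) : Finset ℕ := (Finset.range (Y + 1)).filter fun p => p.Prime ∧ ¬ p ∣ q

open Classical in
/-- The indicator function of the integers with a square divisor `d ^ 2` with `d > Y`. -/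
noncomputable def largeSquareIndicator (Y n : ℕ) : ℝ := if ∃ d, Y < d ∧ d ^ 2 ∣ n then 1 else 0

theorem largeSquareIndicator_nonneg (Y n : ℕ) : 0 ≤ largeSquareIndicator Y n := by
  unfold largeSquareIndicator
  split_ifs <;> norm_num

/-- A union bound over `d > Y`, with the telescoping estimate for `∑ 1/d²`. -/
theorem sum_largeSquareIndicator_le {Y : ℕ} (hY : 0 < Y) (X : ℕ) :
    ∑ n ∈ Finset.Icc 1 X, largeSquareIndicator Y n ≤ X * (1 / (Y : ℝ)) := by
  calc ∑ n ∈ Finset.Icc 1 X, largeSquareIndicator Y n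
      ≤ ∑ n ∈ Finset.Icc 1 X, ∑ d ∈ Finset.Ioc Y X, if d ^ 2 ∣ n then (1 : ℝ) else 0 := by
        refine Finset.sum_le_sum fun n hn => ?_
        have h0 : ∀ d ∈ Finset.Ioc Y X, 0 ≤ if d ^ 2 ∣ n then (1 : ℝ) else 0 := by
          intro d _
          split_ifs <;> norm_num
        unfold largeSquareIndicator
        split_ifs with h
        · obtain ⟨d, hd, hdn⟩ := h
          obtain ⟨hn1, hnX⟩ := Finset.mem_Icc.1 hn
          have hdX : d ≤ X := (Nat.le_self_pow two_ne_zero d).trans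
            ((Nat.le_of_dvd (by omega) hdn).trans hnX)
          refine le_trans ?_ (Finset.single_le_sum h0 (Finset.mem_Ioc.2 ⟨hd, hdX⟩))
          simp [hdn]
        · exact Finset.sum_nonneg h0
    _ ≤ ∑ d ∈ Finset.Ioc Y X, X * ((d : ℝ) ^ 2)⁻¹ := by
        rw [Finset.sum_comm]
        refine Finset.sum_le_sum fun d hd => ?_
        rw [← Finset.sum_filter, Finset.sum_const, nsmul_eq_mul, mul_one,
          show Finset.Icc 1 X = Finset.Ioc 0 X from rfl, Nat.Ioc_filter_dvd_card_eq_div,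
          ← div_eq_mul_inv]
        exact_mod_cast Nat.cast_div_le (α := ℝ)
    _ ≤ _ := by
        rw [← Finset.mul_sum]
        refine mul_le_mul_of_nonneg_left ?_ (by positivity)
        rcases le_total Y X with h | h
        · refine (sum_Ioc_inv_sq_le_sub hY.ne' h).trans ?_
          rw [one_div]
          have : (0 : ℝ) ≤ (X : ℝ)⁻¹ := by positivity
          linarith
        · rw [Finset.Ioc_eq_empty (by omega)]
          simp

/-! ### The sieved approximation: its error, its expansion and its mean square. -/

section Approximation

variable {q : ℕ} (χ : DirichletCharacter ℝ q)

theorem abs_powerFreePart_char_le (k n : ℕ) :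
    |powerFreePart k (fun m => χ (m : ZMod q)) n| ≤ 1 := by
  unfold powerFreePart
  split_ifs
  · exact abs_char_le_one χ _
  · simp

theorem abs_sievedPart_char_le (k : ℕ) (P : Finset ℕ) (n : ℕ) :
    |sievedPart k P (fun m => χ (m : ZMod q)) n| ≤ 1 := by
  rw [sievedPart, prod_one_sub_indicator]
  split_ifs
  · simp
  · simpa using abs_char_le_one χ _

theorem abs_powerFreePart_sub_sievedPart_le {k : ℕ} (hk : 2 ≤ k) (Y m : ℕ) :
    |powerFreePart k (fun m => χ (m : ZMod q)) m -
      sievedPart k (primesUpTo q Y) (fun m => χ (m : ZMod q)) m| ≤ largeSquareIndicator Y m := by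
  rw [sievedPart, prod_one_sub_indicator]
  by_cases h1 : ∃ p ∈ primesUpTo q Y, p ^ k ∣ m
  · obtain ⟨p, hp, hpm⟩ := h1
    rw [powerFreePart, if_neg, if_pos ⟨p, hp, hpm⟩]
    · simpa using largeSquareIndicator_nonneg Y m
    · exact fun h => h p (Finset.mem_filter.1 hp).2.1 hpm
  · rw [if_neg h1, mul_one, powerFreePart]
    split_ifs with h2
    · simpa using largeSquareIndicator_nonneg Y m
    · simp only [IsPowerFree] at h2
      push Not at h2
      obtain ⟨p, hp, hpm⟩ := h2
      -- Primes dividing `q` need no sieving: `χ` already vanishes at their multiples.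
      by_cases hpq : p ∣ q
      · rw [char_eq_zero_of_not_coprime]
        · simpa using largeSquareIndicator_nonneg Y m
        · exact Nat.not_coprime_of_dvd_of_dvd hp.one_lt ((dvd_pow_self p (by omega)).trans hpm) hpq
      · have hY : Y < p := by
          by_contra h
          refine h1 ⟨p, ?_, hpm⟩
          simp only [primesUpTo, Finset.mem_filter, Finset.mem_range]
          exact ⟨by omega, hp, hpq⟩
        rw [largeSquareIndicator, if_pos ⟨p, hY, (pow_dvd_pow p hk).trans hpm⟩, zero_sub, abs_neg]
        exact abs_char_le_one χ _

theorem abs_dilationSum_le (E : Finset ℕ) (w : ℕ → ℝ) {g : ℕ → ℝ} (hg : ∀ n, |g n| ≤ 1) (n : ℕ) :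
    |dilationSum E w g n| ≤ ∑ e ∈ E, |w e| := by
  refine (Finset.abs_sum_le_sum_abs _ _).trans (Finset.sum_le_sum fun e _ => ?_)
  rw [abs_mul]
  refine mul_le_of_le_one_right (abs_nonneg _) ?_
  split_ifs
  · exact hg _
  · simp

theorem abs_dilationSum_sub_le (E : Finset ℕ) (w : ℕ → ℝ) {g h : ℕ → ℝ} {Y : ℕ}
    (hgh : ∀ n, |g n - h n| ≤ largeSquareIndicator Y n) (n : ℕ) :
    |dilationSum E w g n - dilationSum E w h n| ≤
      (∑ e ∈ E, |w e|) * largeSquareIndicator Y n := by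
  unfold dilationSum
  rw [← Finset.sum_sub_distrib, Finset.sum_mul]
  refine (Finset.abs_sum_le_sum_abs _ _).trans (Finset.sum_le_sum fun e _ => ?_)
  rw [← mul_sub, abs_mul]
  refine mul_le_mul_of_nonneg_left ?_ (abs_nonneg _)
  split_ifs with hen
  · refine (hgh _).trans ?_
    -- A large square divisor of `n / e` also divides `n`, so the exceptional set is not enlarged.
    unfold largeSquareIndicator
    split_ifs with h1 h2
    · exact le_rfl
    · obtain ⟨d, hd, hdn⟩ := h1
      exact absurd ⟨d, hd, hdn.trans (Nat.div_dvd_of_dvd hen)⟩ h2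
    · norm_num
    · exact le_rfl
  · simpa using largeSquareIndicator_nonneg Y n

theorem prod_pow_dvd_iff {k : ℕ} {t : Finset ℕ} (ht : ∀ p ∈ t, p.Prime) (n : ℕ) :
    (∏ p ∈ t, p) ^ k ∣ n ↔ ∀ p ∈ t, p ^ k ∣ n := by
  constructor
  · exact fun h p hp => (pow_dvd_pow_of_dvd (Finset.dvd_prod_of_mem _ hp) k).trans h
  · intro h
    rw [← Finset.prod_pow]
    refine Finset.prod_dvd_of_isRelPrime (fun p hp p' hp' hne => ?_) h
    rw [Function.onFun, ← Nat.coprime_iff_isRelPrime]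
    exact Nat.coprime_pow_primes k k (ht p hp) (ht p' hp') hne

/-- Inclusion-exclusion over `t ⊆ P`: with `d = ∏ p ∈ t, p` and `d ^ k ∣ n`, `χ(n)` factors as
`χ(d^k) χ(n / d^k)`. -/
theorem sievedPart_eq_sum {k : ℕ} {P : Finset ℕ} (hP : ∀ p ∈ P, p.Prime) (n : ℕ) :
    sievedPart k P (fun m => χ (m : ZMod q)) n =
      ∑ t ∈ P.powerset, ((-1) ^ t.card * χ (((∏ p ∈ t, p) ^ k : ℕ) : ZMod q)) *
        dilatedChar χ ((∏ p ∈ t, p) ^ k) n := by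
  unfold sievedPart
  simp only [sub_eq_neg_add]
  rw [Finset.prod_add_one, Finset.mul_sum]
  refine Finset.sum_congr rfl fun t ht => ?_
  have htp : ∀ p ∈ t, p.Prime := fun p hp => hP p (Finset.mem_powerset.1 ht hp)
  rw [Finset.prod_neg, mul_assoc, mul_left_comm]
  congr 1
  unfold dilatedChar
  by_cases h : (∏ p ∈ t, p) ^ k ∣ n
  · rw [if_pos h, Finset.prod_eq_one, mul_one, ← map_mul, ← Nat.cast_mul, Nat.mul_div_cancel' h]
    intro p hp
    rw [if_pos ((prod_pow_dvd_iff htp n).1 h p hp)]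
  · rw [if_neg h, mul_zero]
    rw [prod_pow_dvd_iff htp] at h
    push Not at h
    obtain ⟨p, hp, hpn⟩ := h
    rw [Finset.prod_eq_zero hp (by simp [hpn]), mul_zero]

theorem dilationSum_sievedPart {k : ℕ} {P : Finset ℕ} (hP : ∀ p ∈ P, p.Prime) (E : Finset ℕ)
    (hE : ∀ e ∈ E, 0 < e) (w : ℕ → ℝ) (n : ℕ) :
    dilationSum E w (sievedPart k P fun m => χ (m : ZMod q)) n =
      ∑ e ∈ E, w e * ∑ t ∈ P.powerset,
        ((-1) ^ t.card * χ (((∏ p ∈ t, p) ^ k : ℕ) : ZMod q)) *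
          dilatedChar χ (e * (∏ p ∈ t, p) ^ k) n := by
  refine Finset.sum_congr rfl fun e he => ?_
  congr 1
  by_cases h : e ∣ n
  · obtain ⟨m, rfl⟩ := h
    rw [if_pos (dvd_mul_right _ _), Nat.mul_div_cancel_left _ (hE e he), sievedPart_eq_sum χ hP]
    simp only [dilatedChar_mul_left χ (hE e he)]
  · rw [if_neg h, Finset.sum_eq_zero]
    intro t _
    rw [dilatedChar, if_neg (fun hd => h ((dvd_mul_right _ _).trans hd)), mul_zero]

theorem dilationSum_sievedPart_periodic {k : ℕ} {P : Finset ℕ} (hP : ∀ p ∈ P, p.Prime)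
    (E : Finset ℕ) (hE : ∀ e ∈ E, 0 < e) (w : ℕ → ℝ) {N : ℕ}
    (hN : ∀ e ∈ E, ∀ t ∈ P.powerset, e * (∏ p ∈ t, p) ^ k * q ∣ N) :
    Function.Periodic (dilationSum E w (sievedPart k P fun m => χ (m : ZMod q))) N := by
  intro n
  rw [dilationSum_sievedPart χ hP E hE, dilationSum_sievedPart χ hP E hE]
  refine Finset.sum_congr rfl fun e he => ?_
  congr 1
  refine Finset.sum_congr rfl fun t ht => ?_
  congr 1
  have hpos : 0 < ∏ p ∈ t, p :=
    Finset.prod_pos fun p hp => (hP p (Finset.mem_powerset.1 ht hp)).pos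
  have := hE e he
  exact periodic_of_dvd (dilatedChar_periodic χ (by positivity)) (hN e he t ht) n

/-- Cauchy–Schwarz over the finite set `E` reduces to a single `e`; the resulting constant does not
depend on `P`. -/
theorem sum_windowSum_sieved_sq_le (hq : 0 < q) (hne : χ ≠ 1) {k : ℕ} (hk : 2 ≤ k) {P : Finset ℕ}
    (hP : ∀ p ∈ P, p.Prime) (hPq : ∀ p ∈ P, ¬ p ∣ q) (E : Finset ℕ) (hE : ∀ e ∈ E, 0 < e)
    (w : ℕ → ℝ) {N : ℕ} (hN : ∀ e ∈ E, ∀ t ∈ P.powerset, e * (∏ p ∈ t, p) ^ k * q ∣ N)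
    {H : ℕ} (hH : 1 ≤ H) :
    ∑ n ∈ Finset.range N,
        windowSum (dilationSum E w (sievedPart k P fun m => χ (m : ZMod q))) H n ^ 2 ≤
      N * ((E.card * (∑ e ∈ E, w e ^ 2) * (192 * q ^ 2)) * (H : ℝ) ^ ((1 : ℝ) / k)) := by
  set c : Finset ℕ → ℝ := fun t => (-1) ^ t.card * χ (((∏ p ∈ t, p) ^ k : ℕ) : ZMod q) with hc
  have hwin : ∀ n, windowSum (dilationSum E w (sievedPart k P fun m => χ (m : ZMod q))) H n =
      ∑ e ∈ E, w e * ∑ t ∈ P.powerset,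
        c t * windowSum (dilatedChar χ (e * (∏ p ∈ t, p) ^ k)) H n := by
    intro n
    unfold windowSum
    simp only [dilationSum_sievedPart χ hP E hE]
    rw [Finset.sum_comm]
    refine Finset.sum_congr rfl fun e _ => ?_
    rw [← Finset.mul_sum, Finset.sum_comm]
    congr 1
    exact Finset.sum_congr rfl fun t _ => (Finset.mul_sum _ _ _).symm
  have htP : ∀ t ∈ P.powerset, ∀ p ∈ t, p ∈ P := fun t ht p hp => Finset.mem_powerset.1 ht hp
  have hmain : ∀ e ∈ E, ∑ n ∈ Finset.range N, (∑ t ∈ P.powerset,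
      c t * windowSum (dilatedChar χ (e * (∏ p ∈ t, p) ^ k)) H n) ^ 2 ≤
        192 * q ^ 2 * N * (H : ℝ) ^ ((1 : ℝ) / k) := by
    intro e he
    refine sum_sq_combination_windowSum_le χ hq hne P.powerset (fun t => ∏ p ∈ t, p) ?_ ?_ ?_ c ?_
      hk (hE e he) (hN e he) hH
    · exact fun t ht => Finset.prod_pos fun p hp => (hP p (htP t ht p hp)).pos
    · exact fun t ht => Nat.Coprime.prod_left fun p hp =>
        (hP p (htP t ht p hp)).coprime_iff_not_dvd.2 (hPq p (htP t ht p hp))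
    -- A set of primes is the set of prime factors of its product.
    · intro t ht t' ht' h
      rw [← Nat.primeFactors_prod fun p hp => hP p (htP t ht p hp),
        ← Nat.primeFactors_prod fun p hp => hP p (htP t' ht' p hp)]
      exact congrArg _ h
    · intro t _
      simp only [hc, abs_mul, abs_pow, abs_neg, abs_one, one_pow, one_mul]
      exact abs_char_le_one χ _
  simp only [hwin]
  calc _ ≤ ∑ n ∈ Finset.range N, E.card * ∑ e ∈ E, (w e * ∑ t ∈ P.powerset,
          c t * windowSum (dilatedChar χ (e * (∏ p ∈ t, p) ^ k)) H n) ^ 2 :=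
        Finset.sum_le_sum fun n _ => sq_sum_le_card_mul_sum_sq
    _ = E.card * ∑ e ∈ E, w e ^ 2 * ∑ n ∈ Finset.range N, (∑ t ∈ P.powerset,
          c t * windowSum (dilatedChar χ (e * (∏ p ∈ t, p) ^ k)) H n) ^ 2 := by
        rw [← Finset.mul_sum, Finset.sum_comm]
        refine congrArg _ (Finset.sum_congr rfl fun e _ => ?_)
        rw [Finset.mul_sum]
        exact Finset.sum_congr rfl fun n _ => mul_pow _ _ _
    _ ≤ E.card * ∑ e ∈ E, w e ^ 2 * (192 * q ^ 2 * N * (H : ℝ) ^ ((1 : ℝ) / k)) := by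
        refine mul_le_mul_of_nonneg_left (Finset.sum_le_sum fun e he => ?_) (by positivity)
        exact mul_le_mul_of_nonneg_left (hmain e he) (sq_nonneg _)
    _ = _ := by
        rw [← Finset.sum_mul]
        ring

end Approximation

/-! ### Mean values, exchange of limits, and stability of the mean square. -/

/-- With mean zero the partial sums are themselves periodic, hence bounded. -/
theorem abs_sum_range_le_of_periodic {G : ℕ → ℝ} {N : ℕ} (hG : Function.Periodic G N) (hN : 0 < N)
    (h0 : ∑ n ∈ Finset.range N, G n = 0) (M : ℕ) :
    |∑ n ∈ Finset.range M, G n| ≤ ∑ n ∈ Finset.range N, |G n| := by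
  have hper : Function.Periodic (fun M => ∑ n ∈ Finset.range M, G n) N := by
    intro M
    simp only []
    rw [Finset.sum_range_add]
    simp only [add_comm M]
    rw [sum_range_add_of_periodic hG, h0, add_zero]
  rw [← hper.map_mod_nat M]
  refine (Finset.abs_sum_le_sum_abs _ _).trans ?_
  refine Finset.sum_le_sum_of_subset_of_nonneg ?_ fun _ _ _ => abs_nonneg _
  exact Finset.range_subset_range.2 (Nat.mod_lt _ hN).le

/-- A periodic sequence has a mean value, the mean over a period. -/
theorem tendsto_mean_of_periodic {F : ℕ → ℝ} {N : ℕ} (hF : Function.Periodic F N) (hN : 0 < N) :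
    Tendsto (fun x : ℝ => 1 / x * ∑ n ∈ Finset.Icc 1 ⌊x⌋₊, F n) atTop
      (𝓝 ((∑ n ∈ Finset.range N, F n) / N)) := by
  have hN0 : (N : ℝ) ≠ 0 := by positivity
  set μ := (∑ n ∈ Finset.range N, F n) / N with hμ
  set G : ℕ → ℝ := fun n => F (n + 1) - μ with hGdef
  have hG : Function.Periodic G N := by
    intro n
    simp only [hGdef]
    rw [add_right_comm, hF]
  have hG0 : ∑ n ∈ Finset.range N, G n = 0 := by
    simp only [hGdef]
    rw [Finset.sum_sub_distrib, sum_range_add_of_periodic hF 1]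
    simp only [Finset.sum_const, Finset.card_range, nsmul_eq_mul]
    rw [hμ, mul_div_cancel₀ _ hN0, sub_self]
  set B := ∑ n ∈ Finset.range N, |G n|
  have hsum : ∀ M : ℕ, ∑ n ∈ Finset.Icc 1 M, F n = ∑ n ∈ Finset.range M, G n + M * μ := by
    intro M
    simp only [hGdef, Finset.sum_sub_distrib, Finset.sum_const, Finset.card_range, nsmul_eq_mul,
      sub_add_cancel]
    rw [show Finset.Icc 1 M = Finset.Ico 1 (M + 1) from rfl, Finset.sum_Ico_eq_sum_range]
    simp [add_comm]
  have h1 : Tendsto (fun x : ℝ => 1 / x * ∑ n ∈ Finset.range ⌊x⌋₊, G n) atTop (𝓝 0) := by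
    refine squeeze_zero_norm' (a := fun x : ℝ => B / x) ?_ (tendsto_const_nhds.div_atTop tendsto_id)
    filter_upwards [eventually_gt_atTop 0] with x hx
    rw [norm_mul, Real.norm_eq_abs, Real.norm_eq_abs, abs_of_pos (by positivity), one_div_mul_eq_div]
    exact div_le_div_of_nonneg_right (abs_sum_range_le_of_periodic hG hN hG0 _) hx.le
  have h2 := (tendsto_nat_floor_div_atTop (R := ℝ)).mul_const μ
  have h3 := h1.add h2
  rw [zero_add, one_mul] at h3
  refine h3.congr fun x => ?_
  rw [hsum]
  ring

/-- A function that is uniformly approximated, with errors tending to zero, by functions having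
bounded limits, has a limit with the same bound. -/
theorem exists_tendsto_of_approx {F : ℝ → ℝ} {Fs : ℕ → ℝ → ℝ} {L : ℕ → ℝ} {K B : ℝ}
    (hL : ∀ Y, 0 < Y → Tendsto (Fs Y) atTop (𝓝 (L Y)))
    (hF : ∀ Y, 0 < Y → ∀ x, 1 ≤ x → |F x - Fs Y x| ≤ K * (1 / (Y : ℝ)))
    (hB : ∀ Y, 0 < Y → |L Y| ≤ B) :
    ∃ l, Tendsto F atTop (𝓝 l) ∧ |l| ≤ B := by
  have hK : Tendsto (fun Y : ℕ => K * (1 / (Y : ℝ))) atTop (𝓝 0) := by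
    simpa using tendsto_one_div_atTop_nhds_zero_nat.const_mul K
  -- The shift to `Y + 1` avoids `Y = 0`, where no approximation is assumed. Two limits are compared
  -- through `F x` at large `x`.
  have hcauchy : CauchySeq (fun Y => L (Y + 1)) := by
    rw [Metric.cauchySeq_iff]
    intro ε hε
    obtain ⟨Y₀, hY₀⟩ := eventually_atTop.1
      (hK.eventually_lt_const (show (0 : ℝ) < ε / 3 by positivity))
    refine ⟨Y₀, fun m hm n hn => ?_⟩
    have hlim := ((hL (m + 1) (by omega)).sub (hL (n + 1) (by omega))).abs
    have hle : |L (m + 1) - L (n + 1)| ≤ ε / 3 + ε / 3 := by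
      refine le_of_tendsto hlim ?_
      filter_upwards [eventually_ge_atTop 1] with x hx
      have h1 := abs_le.1 ((hF (m + 1) (by omega) x hx).trans (hY₀ (m + 1) (by omega)).le)
      have h2 := abs_le.1 ((hF (n + 1) (by omega) x hx).trans (hY₀ (n + 1) (by omega)).le)
      rw [abs_le]
      constructor <;> linarith [h1.1, h1.2, h2.1, h2.2]
    rw [Real.dist_eq]
    linarith
  obtain ⟨l, hl⟩ := cauchySeq_tendsto_of_complete hcauchy
  refine ⟨l, ?_, le_of_tendsto' hl.abs fun Y => hB _ (by omega)⟩
  rw [Metric.tendsto_nhds]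
  intro ε hε
  have hl' := Metric.tendsto_nhds.1 hl (ε / 3) (by positivity)
  have hK' := (hK.comp (tendsto_add_atTop_nat 1)).eventually_lt_const
    (show (0 : ℝ) < ε / 3 by positivity)
  obtain ⟨Y, hY1, hY2⟩ := (hl'.and hK').exists
  filter_upwards [eventually_ge_atTop 1,
    Metric.tendsto_nhds.1 (hL (Y + 1) (by omega)) (ε / 3) (by positivity)] with x hx1 hx2
  have h1 := (hF (Y + 1) (by omega) x hx1).trans_lt hY2
  rw [Real.dist_eq] at *
  calc |F x - l| = |(F x - Fs (Y + 1) x) + (Fs (Y + 1) x - L (Y + 1)) + (L (Y + 1) - l)| := by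
        congr 1; ring
    _ ≤ |F x - Fs (Y + 1) x| + |Fs (Y + 1) x - L (Y + 1)| + |L (Y + 1) - l| := abs_add_three _ _ _
    _ < ε := by linarith

theorem abs_windowSum_le {f : ℕ → ℝ} {A : ℝ} (hf : ∀ n, 0 < n → |f n| ≤ A) (H n : ℕ) :
    |windowSum f H n| ≤ H * A := by
  rw [windowSum_eq_sum_range]
  refine (Finset.abs_sum_le_sum_abs _ _).trans ?_
  calc _ ≤ ∑ _k ∈ Finset.range H, A := Finset.sum_le_sum fun k _ => hf _ (by omega)
    _ = _ := by simp

theorem shortSumMeanSquare_eq (f : ℕ → ℝ) (H : ℕ) (x : ℝ) :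
    shortSumMeanSquare f H x = 1 / x * ∑ n ∈ Finset.Icc 1 ⌊x⌋₊, windowSum f H n ^ 2 := by
  simp only [shortSumMeanSquare, sq_abs, windowSum]

/-- The mean squares of two bounded functions are close if the functions are close in the mean. -/
theorem abs_shortSumMeanSquare_sub_le {f g δ : ℕ → ℝ} {A ε : ℝ} (hA : 0 ≤ A)
    (hf : ∀ n, 0 < n → |f n| ≤ A) (hg : ∀ n, 0 < n → |g n| ≤ A)
    (hδ : ∀ n, 0 ≤ δ n) (hfg : ∀ n, 0 < n → |f n - g n| ≤ A * δ n) (hε : 0 ≤ ε)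
    (hsum : ∀ X : ℕ, ∑ n ∈ Finset.Icc 1 X, δ n ≤ X * ε) (H : ℕ) {x : ℝ} (hx : 1 ≤ x) :
    |shortSumMeanSquare f H x - shortSumMeanSquare g H x| ≤
      (2 * H ^ 2 * A ^ 2 * (1 + H)) * ε := by
  rw [shortSumMeanSquare_eq, shortSumMeanSquare_eq, ← mul_sub, ← Finset.sum_sub_distrib, abs_mul,
    abs_of_pos (by positivity), one_div_mul_eq_div, div_le_iff₀ (by linarith)]
  set X := ⌊x⌋₊
  have hX : (X : ℝ) ≤ x := Nat.floor_le (by linarith)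
  have hshift : ∀ j ∈ Finset.range H, ∑ n ∈ Finset.Icc 1 X, δ (n + 1 + j) ≤ (X + H) * ε := by
    intro j hj
    have hj' := Finset.mem_range.1 hj
    calc ∑ n ∈ Finset.Icc 1 X, δ (n + 1 + j)
        = ∑ m ∈ Finset.Icc (1 + (1 + j)) (X + (1 + j)), δ m := by
          rw [← Finset.map_add_right_Icc, Finset.sum_map]
          simp [add_assoc]
      _ ≤ ∑ m ∈ Finset.Icc 1 (X + H), δ m :=
          Finset.sum_le_sum_of_subset_of_nonneg
            (Finset.Icc_subset_Icc (by omega) (by omega)) fun _ _ _ => hδ _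
      _ ≤ _ := by simpa using hsum (X + H)
  calc |∑ n ∈ Finset.Icc 1 X, (windowSum f H n ^ 2 - windowSum g H n ^ 2)|
      ≤ ∑ n ∈ Finset.Icc 1 X, 2 * (H * A) * (A * ∑ j ∈ Finset.range H, δ (n + 1 + j)) := by
        refine (Finset.abs_sum_le_sum_abs _ _).trans (Finset.sum_le_sum fun n _ => ?_)
        -- The sum of the window sums is at most `2 * H * A`; their difference is controlled by `δ`
        -- on the window.
        rw [sq_sub_sq, abs_mul]
        refine mul_le_mul ?_ ?_ (abs_nonneg _) (by positivity)
        · refine (abs_add_le _ _).trans ?_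
          linarith [abs_windowSum_le hf H n, abs_windowSum_le hg H n]
        · rw [windowSum_eq_sum_range, windowSum_eq_sum_range, ← Finset.sum_sub_distrib,
            Finset.mul_sum]
          exact (Finset.abs_sum_le_sum_abs _ _).trans
            (Finset.sum_le_sum fun j _ => hfg _ (by omega))
    _ = 2 * H * A ^ 2 * ∑ j ∈ Finset.range H, ∑ n ∈ Finset.Icc 1 X, δ (n + 1 + j) := by
        rw [Finset.sum_comm (s := Finset.range H), Finset.mul_sum]
        exact Finset.sum_congr rfl fun n _ => by ring
    _ ≤ 2 * H * A ^ 2 * (H * ((X + H) * ε)) := by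
        refine mul_le_mul_of_nonneg_left ?_ (by positivity)
        refine (Finset.sum_le_sum hshift).trans ?_
        simp
    _ ≤ 2 * H * A ^ 2 * (H * ((x * (1 + H)) * ε)) := by
        have hH : (0 : ℝ) ≤ H := by positivity
        have : (X : ℝ) + H ≤ x * (1 + H) := by nlinarith
        gcongr
    _ = _ := by ring

/-! ### Conclusion for `k`-free parts, and the cases `k = 2, 3`. -/

/-- The mean square of the sums of the `k`-free part of `χs` over intervals of length `H` exists
and is `O (H ^ (1 / k))`. -/
theorem exists_limitingMeanSquare_powerFreePart {q : ℕ} (hq : 0 < q) (χ : DirichletCharacter ℝ q)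
    (hne : χ ≠ 1) {χs : ℕ → ℝ} (hχs : IsCompletelyMultiplicativeExtension χ χs) {k : ℕ}
    (hk : 2 ≤ k) :
    ∃ Λ : ℕ → ℝ,
      (∀ H : ℕ, 1 ≤ H → HasLimitingMeanSquare (powerFreePart k χs) H (Λ H)) ∧
      ∃ C : ℝ, 0 < C ∧ ∀ H : ℕ, 1 ≤ H → |Λ H| ≤ C * (H : ℝ) ^ ((1 : ℝ) / k) := by
  set E := powerFreeDivisors q k
  set A := ∑ e ∈ E, |χs e|
  set C : ℝ := E.card * (∑ e ∈ E, χs e ^ 2) * (192 * q ^ 2)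
  have hC0 : 0 ≤ C := by positivity
  have hE : ∀ e ∈ E, e ∣ q ^ k := fun e he => by
    classical
    exact (Nat.mem_divisors.1 (Finset.mem_filter.1 he).1).1
  have hE0 : ∀ e ∈ E, 0 < e := fun e he => Nat.pos_of_dvd_of_pos (hE e he) (by positivity)
  have hlim : ∀ H : ℕ, 1 ≤ H → ∃ l, HasLimitingMeanSquare (powerFreePart k χs) H l ∧
      |l| ≤ C * (H : ℝ) ^ ((1 : ℝ) / k) := by
    intro H hH
    let P : ℕ → Finset ℕ := primesUpTo q
    have hP : ∀ Y, ∀ p ∈ P Y, p.Prime := fun Y p hp => (Finset.mem_filter.1 hp).2.1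
    have hPq : ∀ Y, ∀ p ∈ P Y, ¬ p ∣ q := fun Y p hp => (Finset.mem_filter.1 hp).2.2
    let f : ℕ → ℕ → ℝ := fun Y =>
      dilationSum E χs (sievedPart k (P Y) fun m => χ (m : ZMod q))
    -- A common period of all dilates that occur, since `e ∣ q ^ k` and `t ⊆ P Y`.
    let N : ℕ → ℕ := fun Y => q ^ k * (∏ p ∈ P Y, p) ^ k * q
    have hN0 : ∀ Y, 0 < N Y := fun Y => by
      have : 0 < ∏ p ∈ P Y, p := Finset.prod_pos fun p hp => (hP Y p hp).pos
      positivity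
    have hN : ∀ Y, ∀ e ∈ E, ∀ t ∈ (P Y).powerset, e * (∏ p ∈ t, p) ^ k * q ∣ N Y :=
      fun Y e he t ht => mul_dvd_mul (mul_dvd_mul (hE e he) (pow_dvd_pow_of_dvd
        (Finset.prod_dvd_prod_of_subset _ _ _ (Finset.mem_powerset.1 ht)) k)) dvd_rfl
    have hper : ∀ Y, Function.Periodic (fun n => windowSum (f Y) H n ^ 2) (N Y) := by
      intro Y n
      simp only []
      rw [windowSum_periodic
        (dilationSum_sievedPart_periodic χ (hP Y) E hE0 χs (hN Y)) H n]
    refine exists_tendsto_of_approx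
      (Fs := fun Y => shortSumMeanSquare (f Y) H)
      (L := fun Y => (∑ n ∈ Finset.range (N Y), windowSum (f Y) H n ^ 2) / N Y)
      (K := 2 * H ^ 2 * A ^ 2 * (1 + H)) ?_ ?_ ?_
    · intro Y _
      refine (tendsto_mean_of_periodic (hper Y) (hN0 Y)).congr fun x => ?_
      rw [shortSumMeanSquare_eq]
    · intro Y hY x hx
      refine abs_shortSumMeanSquare_sub_le (Finset.sum_nonneg fun _ _ => abs_nonneg _) ?_ ?_
        (largeSquareIndicator_nonneg Y) ?_ (by positivity) (sum_largeSquareIndicator_le hY) H hx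
      · intro n hn
        rw [powerFreePart_eq_dilationSum hχs hq k hn]
        exact abs_dilationSum_le _ _ (abs_powerFreePart_char_le χ k) n
      · exact fun n _ => abs_dilationSum_le _ _ (abs_sievedPart_char_le χ k _) n
      · intro n hn
        rw [powerFreePart_eq_dilationSum hχs hq k hn]
        exact abs_dilationSum_sub_le _ _ (abs_powerFreePart_sub_sievedPart_le χ hk Y) n
    · intro Y _
      have hpos : (0 : ℝ) < N Y := by exact_mod_cast hN0 Y
      rw [abs_of_nonneg (div_nonneg (Finset.sum_nonneg fun _ _ => sq_nonneg _) hpos.le),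
        div_le_iff₀' hpos]
      exact sum_windowSum_sieved_sq_le χ hq hne hk (hP Y) (hPq Y) E hE0 χs (hN Y) hH
  choose Λ hΛ using hlim
  -- The value at `H = 0` is arbitrary; `C + 1` secures positivity from `0 ≤ C`.
  refine ⟨fun H => if h : 1 ≤ H then Λ H h else 0, fun H hH => ?_, C + 1, by linarith,
    fun H hH => ?_⟩
  · simp only [dif_pos hH]
    exact (hΛ H hH).1
  · simp only [dif_pos hH]
    refine (hΛ H hH).2.trans (mul_le_mul_of_nonneg_right (by linarith) (by positivity))

theorem squarefreePart_eq (g : ℕ → ℝ) : squarefreePart g = powerFreePart 2 g := by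
  ext n
  have : Squarefree n ↔ IsPowerFree 2 n := by
    simp only [Nat.squarefree_iff_prime_squarefree, IsPowerFree, sq]
  unfold squarefreePart powerFreePart
  rw [← Int.cast_pow, ArithmeticFunction.moebius_sq]
  by_cases h : Squarefree n
  · rw [if_pos h, if_pos (this.1 h)]
    simp
  · rw [if_neg h, if_neg (mt this.2 h)]
    simp

theorem cubefreePart_eq (g : ℕ → ℝ) : cubefreePart g = powerFreePart 3 g := by
  ext n
  unfold cubefreePart cubefreeIndicator powerFreePart
  by_cases h : IsCubefree n
  · rw [if_pos h, if_pos (show IsPowerFree 3 n from h), one_mul]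
  · rw [if_neg h, if_neg (show ¬ IsPowerFree 3 n from h), zero_mul]

theorem theorem1p3 (q : ℕ) (hq : 0 < q) (χ : DirichletCharacter ℝ q) (hprim : χ.IsPrimitive)
    (hne : χ ≠ 1) (χs : ℕ → ℝ) (hχs : IsCompletelyMultiplicativeExtension χ χs) :
    (∃ Λ : ℕ → ℝ,
      (∀ H : ℕ, 1 ≤ H → HasLimitingMeanSquare (squarefreePart χs) H (Λ H)) ∧
      ∃ C : ℝ, 0 < C ∧ ∀ H : ℕ, 1 ≤ H → |Λ H| ≤ C * (H : ℝ) ^ ((1 : ℝ) / 2)) ∧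
    (∃ Λ : ℕ → ℝ,
      (∀ H : ℕ, 1 ≤ H → HasLimitingMeanSquare (cubefreePart χs) H (Λ H)) ∧
      ∃ C : ℝ, 0 < C ∧ ∀ H : ℕ, 1 ≤ H → |Λ H| ≤ C * (H : ℝ) ^ ((1 : ℝ) / 3)) := by
  have h2 := exists_limitingMeanSquare_powerFreePart hq χ hne hχs (k := 2) le_rfl
  have h3 := exists_limitingMeanSquare_powerFreePart hq χ hne hχs (k := 3) (by norm_num)
  rw [squarefreePart_eq, cubefreePart_eq]
  exact ⟨by exact_mod_cast h2, by exact_mod_cast h3⟩
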